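/- Write $\mathcal{M}_n$ for the complex $n\times n$ matrices. A channel $\Phi:\mathcal{M}_n\to\mathcal{M}_m$ is a completely positive trace-preserving linear map; its Choi rank is the minimum $r$ for which $\Phi(X)=\sum_{k=1}^r A_kXA_k^*$ for some $m\times n$ matrices $A_k$. Let $J(\Phi)=\sum_{j,k}\Phi(E_{j,k})\otimes E_{j,k}$, let $\Phi^*$ be the adjoint of $\Phi$ with respect to $\langle A,B\rangle=\operatorname{Tr}(A^*B)$, and let $\operatorname{vec}(A)=\sum_{j,k}A(j,k)\,e_j\otimes e_k$. The operator system of $\Phi$ is $\mathcal{S}_\Phi=\{A\in\mathcal{M}_n:\operatorname{vec}(A)\in\operatorname{im}J(\Phi^*\Phi)\}$ (equivalently, the span of all $A_j^*A_k$ for any Kraus representation as above). A unitary channel is a map $X\mapsto UXU^*$ with $U$ unitary; a mixed-unitary channel is a convex combination of unitary channels, and its mixed-unitary rank is the minimum number of terms in such a convex combination. The direct sum $\Phi\oplus\Psi$ sends a block matrix with diagonal blocks $X,Y$ to the block-diagonal matrix with blocks $\Phi(X),\Psi(Y)$. A correlation matrix is a positive semidefinite matrix with all diagonal entries equal to $1$;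 it is toroidal if it is a convex combination $\sum_{k=1}^N p_ku_ku_k^*$ with all entries of all $u_k$ of modulus $1$, and its toroidal rank is then the least such $N$. Let $d$ be a positive integer and suppose that $\mathcal{A}_t=\{u_{t,1},\dots,u_{t,d}\}$, $t=1,\dots,d+1$, are $d+1$ mutually unbiased bases of $\mathbb{C}^d$, i.e. orthonormal bases such that $|\langle u,v\rangle|=1/\sqrt d$ for all $u\in\mathcal{A}_s$, $v\in\mathcal{A}_t$ with $s\ne t$. Let $$A=\sum_{k,j=1}^d (e_k\otimes e_j)\,u_{k,j}^*\in\mathcal{M}_{d^2,d},\qquad C=AA^*\in\mathcal{M}_{d^2}.$$ Then: 1. $C$ is a toroidal correlation matrix with $\operatorname{rank}(C)=d$ and toroidal rank $d$, and $\operatorname{rank}(\overline{C}\odot C)=d^2-d+1$, where $\odot$ is the entrywise product. 2. The Schur map $\Phi:\mathcal{M}_{d^2}\to\mathcal{M}_{d^2}$, $\Phi(X)=C\odot X$, is a channel with Choi rank $d$ and $\dim\mathcal{S}_\Phi=d^2-d+1$. 3. For every positive integer $m$ and every unitary channel $\Psi:\mathcal{M}_m\to\mathcal{M}_m$, the direct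 sum $\Phi\oplus\Psi$ is a mixed-unitary channel with Choi rank $d+1$ and mixed-unitary rank $2d$. 4. In particular, the block-diagonal matrix $C\oplus(1)\in\mathcal{M}_{d^2+1}$ is a toroidal correlation matrix with rank $d+1$ and toroidal rank $2d$. -/

import Mathlib

open scoped Matrix Kronecker ComplexOrder

namespace MUBChannel

noncomputable section

/-! ### Linear maps between matrix algebras, channels -/

/-- A linear map from `n × n` complex matrices to `m × m` complex matrices. -/
abbrev MatMap (n m : Type*) := Matrix n n ℂ →ₗ[ℂ] Matrix m m ℂ

/-- The amplification `id_k ⊗ Φ`, which applies `Φ` to each block of a `k × k` block matrix. -/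
def amplify {n m : Type*} (k : ℕ) (Φ : MatMap n m)
    (X : Matrix (Fin k × n) (Fin k × n) ℂ) : Matrix (Fin k × m) (Fin k × m) ℂ :=
  Matrix.of fun p q => Φ (Matrix.of fun i j => X (p.1, i) (q.1, j)) p.2 q.2

/-- Complete positivity: every amplification preserves positive semidefiniteness. -/
def IsCompletelyPositive {n m : Type*} (Φ : MatMap n m) : Prop :=
  ∀ (k : ℕ) (X : Matrix (Fin k × n) (Fin k × n) ℂ), X.PosSemidef → (amplify k Φ X).PosSemidef

/-- A (quantum) channel: a completely positive and trace-preserving linear map. -/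
def IsChannel {n m : Type*} [Fintype n] [Fintype m] (Φ : MatMap n m) : Prop :=
  IsCompletelyPositive Φ ∧ ∀ X, (Φ X).trace = X.trace

/-- `Φ` has a Kraus representation `Φ(X) = ∑ₖ Aₖ X Aₖ*` with `r` terms. -/
def HasKrausRepresentation {n m : Type*} [Fintype n] (Φ : MatMap n m) (r : ℕ) : Prop :=
  ∃ A : Fin r → Matrix m n ℂ, ∀ X, Φ X = ∑ k, A k * X * (A k)ᴴ

/-- `Φ` has Choi rank `r`: the minimum number of terms of a Kraus representation exists and
is `r`. -/
def HasChoiRank {n m : Type*} [Fintype n] (Φ : MatMap n m) (r : ℕ) : Prop :=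
  IsLeast {r' : ℕ | HasKrausRepresentation Φ r'} r

/-- The Choi matrix `J(Φ) = ∑ⱼₖ Φ(Eⱼₖ) ⊗ Eⱼₖ`. -/
def choiMatrix {n m : Type*} [Fintype n] [DecidableEq n] (Φ : MatMap n m) :
    Matrix (m × n) (m × n) ℂ :=
  ∑ j, ∑ k, Φ (Matrix.single j k 1) ⊗ₖ Matrix.single j k (1 : ℂ)

/-- The adjoint of `Φ` for the inner product `⟨A, B⟩ = Tr(A* B)`
(characterized in `trace_adjointMap`). -/
def adjointMap {n m : Type*} [DecidableEq n] [Fintype m] (Φ : MatMap n m) : MatMap m n where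
  toFun Y := Matrix.of fun j k => ((Φ (Matrix.single j k 1))ᴴ * Y).trace
  map_add' Y Z := by ext; simp [Matrix.mul_add]
  map_smul' c Y := by ext; simp

theorem trace_adjointMap {n m : Type*} [Fintype n] [DecidableEq n] [Fintype m]
    (Φ : MatMap n m) (X : Matrix n n ℂ) (Y : Matrix m m ℂ) :
    (Yᴴ * Φ X).trace = ((adjointMap Φ Y)ᴴ * X).trace := by
  have h : ∀ j k, star ((adjointMap Φ Y) j k) = (Yᴴ * Φ (Matrix.single j k 1)).trace := by
    intro j k
    simp only [adjointMap, LinearMap.coe_mk, AddHom.coe_mk, Matrix.of_apply]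
    rw [← Matrix.trace_conjTranspose, Matrix.conjTranspose_mul, Matrix.conjTranspose_conjTranspose]
  have hX : X = ∑ j, ∑ k, X j k • Matrix.single j k (1 : ℂ) := by
    conv_lhs => rw [Matrix.matrix_eq_sum_single X]
    simp [Matrix.smul_single]
  conv_lhs => rw [hX]
  simp only [map_sum, map_smul, Matrix.mul_sum, Matrix.trace_sum, Matrix.mul_smul,
    Matrix.trace_smul, ← h, smul_eq_mul]
  rw [Finset.sum_comm]
  simp only [Matrix.trace, Matrix.diag, Matrix.mul_apply, Matrix.conjTranspose_apply, mul_comm]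

/-- The vectorization `vec(A) = ∑ⱼₖ A(j,k) eⱼ ⊗ eₖ`. -/
def vecMap (m n : Type*) : Matrix m n ℂ →ₗ[ℂ] (m × n → ℂ) where
  toFun A p := A p.1 p.2
  map_add' _ _ := rfl
  map_smul' _ _ := rfl

/-- The operator system `{A : vec(A) ∈ im J(Φ* Φ)}` of a channel `Φ`. -/
def operatorSystem {n m : Type*} [Fintype n] [DecidableEq n] [Fintype m] (Φ : MatMap n m) :
    Submodule ℂ (Matrix n n ℂ) :=
  (LinearMap.range (choiMatrix ((adjointMap Φ).comp Φ)).mulVecLin).comap (vecMap n n)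

/-! ### Unitary and mixed-unitary channels -/

/-- `Φ` is a unitary channel: `Φ(X) = U X U*` for a unitary matrix `U`. -/
def IsUnitaryChannel {n : Type*} [Fintype n] [DecidableEq n] (Φ : MatMap n n) : Prop :=
  ∃ U ∈ Matrix.unitaryGroup n ℂ, ∀ X, Φ X = U * X * Uᴴ

/-- `Φ` is a convex combination `Φ(X) = ∑ₖ pₖ Uₖ X Uₖ*` of `N` unitary channels. -/
def HasMixedUnitaryDecomposition {n : Type*} [Fintype n] [DecidableEq n]
    (Φ : MatMap n n) (N : ℕ) : Prop :=
  ∃ (p : Fin N → ℝ) (U : Fin N → Matrix n n ℂ),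
    (∀ k, 0 ≤ p k) ∧ ∑ k, p k = 1 ∧ (∀ k, U k ∈ Matrix.unitaryGroup n ℂ) ∧
      ∀ X, Φ X = ∑ k, (p k : ℂ) • (U k * X * (U k)ᴴ)

/-- `Φ` is a mixed-unitary channel. -/
def IsMixedUnitary {n : Type*} [Fintype n] [DecidableEq n] (Φ : MatMap n n) : Prop :=
  ∃ N, HasMixedUnitaryDecomposition Φ N

/-- `Φ` has mixed-unitary rank `N`: the minimum number of terms of a mixed-unitary decomposition
exists and is `N`. -/
def HasMixedUnitaryRank {n : Type*} [Fintype n] [DecidableEq n] (Φ : MatMap n n) (N : ℕ) : Prop :=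
  IsLeast {N' : ℕ | HasMixedUnitaryDecomposition Φ N'} N

/-- The direct sum `Φ ⊕ Ψ`, sending a block matrix with diagonal blocks `X`, `Y` to the
block-diagonal matrix with blocks `Φ(X)`, `Ψ(Y)`. -/
def directSum {n m : Type*} (Φ : MatMap n n) (Ψ : MatMap m m) : MatMap (n ⊕ m) (n ⊕ m) where
  toFun Z := Matrix.fromBlocks (Φ Z.toBlocks₁₁) 0 0 (Ψ Z.toBlocks₂₂)
  map_add' Z W := by
    have h₁ : (Z + W).toBlocks₁₁ = Z.toBlocks₁₁ + W.toBlocks₁₁ := rfl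
    have h₂ : (Z + W).toBlocks₂₂ = Z.toBlocks₂₂ + W.toBlocks₂₂ := rfl
    simp [h₁, h₂, Matrix.fromBlocks_add]
  map_smul' c Z := by
    have h₁ : (c • Z).toBlocks₁₁ = c • Z.toBlocks₁₁ := rfl
    have h₂ : (c • Z).toBlocks₂₂ = c • Z.toBlocks₂₂ := rfl
    simp [h₁, h₂, Matrix.fromBlocks_smul]

/-! ### Schur maps, correlation matrices, toroidal rank -/

/-- The Schur map `X ↦ C ⊙ X` (entrywise product). -/
def schurMap {n : Type*} (C : Matrix n n ℂ) : MatMap n n where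
  toFun X := C ⊙ X
  map_add' X Y := Matrix.hadamard_add C X Y
  map_smul' c X := Matrix.hadamard_smul C X c

/-- A correlation matrix: positive semidefinite with unit diagonal. -/
def IsCorrelationMatrix {n : Type*} (C : Matrix n n ℂ) : Prop :=
  C.PosSemidef ∧ ∀ i, C i i = 1

/-- `C = ∑ₖ pₖ uₖ uₖ*` is a convex combination of `N` terms, where all entries of the vectors `uₖ`
have modulus one. -/
def HasToroidalDecomposition {n : Type*} (C : Matrix n n ℂ) (N : ℕ) : Prop :=
  ∃ (p : Fin N → ℝ) (u : Fin N → n → ℂ),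
    (∀ k, 0 ≤ p k) ∧ ∑ k, p k = 1 ∧ (∀ k i, ‖u k i‖ = 1) ∧
      C = ∑ k, (p k : ℂ) • Matrix.vecMulVec (u k) (star (u k))

/-- `C` is toroidal with toroidal rank `N`: the minimum number of terms of a toroidal decomposition
exists and is `N`. -/
def HasToroidalRank {n : Type*} (C : Matrix n n ℂ) (N : ℕ) : Prop :=
  IsLeast {N' : ℕ | HasToroidalDecomposition C N'} N

/-! ### Mutually unbiased bases -/

/-- The orthonormal bases `u t = (u t 1, …, u t d)` of `ℂ^d`, for `t` in `Fin N`, are mutually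
unbiased. -/
def MutuallyUnbiased {d N : ℕ}
    (u : Fin N → OrthonormalBasis (Fin d) ℂ (EuclideanSpace ℂ (Fin d))) : Prop :=
  ∀ s t, s ≠ t → ∀ i j, ‖inner ℂ (u s i) (u t j)‖ = 1 / Real.sqrt d

/-- The `d² × d` matrix `A = ∑ₖⱼ (eₖ ⊗ eⱼ) u_{k,j}*` built from the first `d` of the `d + 1` bases:
its row with index `(k, j)` is `u_{k,j}*`. -/
def mubMatrix {d : ℕ} (u : Fin (d + 1) → OrthonormalBasis (Fin d) ℂ (EuclideanSpace ℂ (Fin d))) :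
    Matrix (Fin d × Fin d) (Fin d) ℂ :=
  Matrix.of fun p i => star (u p.1.castSucc p.2 i)

/-- The `d² × d²` matrix `C = A A*`. -/
def mubCorrelation {d : ℕ}
    (u : Fin (d + 1) → OrthonormalBasis (Fin d) ℂ (EuclideanSpace ℂ (Fin d))) :
    Matrix (Fin d × Fin d) (Fin d × Fin d) ℂ :=
  mubMatrix u * (mubMatrix u)ᴴ

end

end MUBChannel

/-!
The Schur map of a matrix `D` carries no more information than `D`: its Kraus representations with
`r` terms correspond to factorizations `D = B B*` with `r` columns
(`hasKrausRepresentation_schurMap_iff`), and its mixed-unitary decompositions to toroidal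
decompositions of `D`, because the unitaries of positive weight must be diagonal
(`hasMixedUnitaryDecomposition_schurMap_iff`). Since `X ↦ U X U*` is conjugate to the Schur map of
the all-ones matrix `J`, the direct sum of the Schur map of `C` with a unitary channel is, up to
conjugation by a unitary, the Schur map of `C ⊕ J` (`directSum_schurMap_apply`). All claims thus
become claims about `C` and `C ⊕ J`.

Since `A* A = d`, the rank of `C = A A*` is `d`. If `v` denotes the last basis, the vectors `√d A vₗ`
have entries of modulus one, by unbiasedness, and give `C` as a convex combination of `d` terms.
Attaching both signs `±1` to each of them gives `C ⊕ J` with `2 d` terms. The matrix `C̄ ⊙ C` is the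
Gram matrix `unbiasedGram d d`, whose kernel is computed in `rank_unbiasedGram`.

The lower bound `2 d` uses that `d + 1` mutually unbiased bases are informationally complete
(`MutuallyUnbiased.eq_zero_of_forall_dotProduct_mulVec_eq_zero`), which again is
a rank computation, for `unbiasedGram (d + 1) d`. Hence a vector `y` with `|⟨w, y⟩| = 1` for all `w`
in the first `d` bases is a multiple of some `vₗ`
(`MutuallyUnbiased.inner_last_mul_inner_last_eq_zero`). A toroidal decomposition of `C ⊕ 1` with
weights `pₖ` amounts to such vectors `yₖ` and phases `αₖ` with `∑ₖ pₖ yₖ yₖ* = 1` and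
`∑ₖ pₖ ᾱₖ yₖ = 0`. By the first equation each `vₗ` is proportional to some `yₖ`, and by the second
one a single `yₖ` cannot be enough, as nothing would cancel it (`two_mul_card_le`).
-/

namespace MUBChannel

/-! ### Kraus representations and mixed-unitary channels -/

section General

variable {n m : Type*} [Fintype n]

/-- Amplifying `X ↦ ∑ₖ Aₖ X Aₖ*` gives `X ↦ ∑ₖ (1 ⊗ Aₖ) X (1 ⊗ Aₖ)*`. -/
theorem HasKrausRepresentation.isCompletelyPositive [Finite m] {Φ : MatMap n m} {r : ℕ}
    (h : HasKrausRepresentation Φ r) : IsCompletelyPositive Φ := by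
  obtain ⟨A, hA⟩ := h
  intro k X hX
  have key : amplify k Φ X = ∑ s, ((1 : Matrix (Fin k) (Fin k) ℂ) ⊗ₖ A s) * X *
      ((1 : Matrix (Fin k) (Fin k) ℂ) ⊗ₖ A s)ᴴ := by
    ext p q
    simp only [amplify, Matrix.of_apply, hA, Matrix.sum_apply]
    refine Finset.sum_congr rfl fun s _ => ?_
    simp [Matrix.mul_apply, Matrix.kroneckerMap_apply, Matrix.one_apply, Fintype.sum_prod_type,
      Finset.sum_mul, apply_ite (starRingEnd ℂ)]
  rw [key]
  exact Matrix.posSemidef_sum _ fun s _ => hX.mul_mul_conjTranspose_same _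

theorem HasKrausRepresentation.conj {Φ Φ' : MatMap n n} {W : Matrix n n ℂ}
    (hW : ∀ X, Φ' X = W * Φ X * Wᴴ) {r : ℕ}
    (h : HasKrausRepresentation Φ r) : HasKrausRepresentation Φ' r := by
  obtain ⟨A, hA⟩ := h
  refine ⟨fun k => W * A k, fun X => ?_⟩
  simp only [hW, hA, Matrix.mul_sum, Matrix.sum_mul, Matrix.conjTranspose_mul, Matrix.mul_assoc]

variable [DecidableEq n]

/-- The Kraus operators are the unitaries scaled by the square roots of their weights. -/
theorem HasMixedUnitaryDecomposition.hasKrausRepresentation {Φ : MatMap n n} {N : ℕ}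
    (h : HasMixedUnitaryDecomposition Φ N) : HasKrausRepresentation Φ N := by
  obtain ⟨p, U, hp, -, -, hΦ⟩ := h
  refine ⟨fun k => ((Real.sqrt (p k) : ℝ) : ℂ) • U k, fun X => ?_⟩
  rw [hΦ]
  refine Finset.sum_congr rfl fun k _ => ?_
  have : ((Real.sqrt (p k) : ℝ) : ℂ) * ((Real.sqrt (p k) : ℝ) : ℂ) = (p k : ℂ) := by
    rw [← Complex.ofReal_mul, Real.mul_self_sqrt (hp k)]
  rw [Matrix.conjTranspose_smul, Matrix.smul_mul, Matrix.mul_smul, Matrix.smul_mul, smul_smul,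
    Complex.star_def, Complex.conj_ofReal, this]

theorem HasMixedUnitaryDecomposition.isChannel {Φ : MatMap n n} {N : ℕ}
    (h : HasMixedUnitaryDecomposition Φ N) : IsChannel Φ := by
  refine ⟨h.hasKrausRepresentation.isCompletelyPositive, fun X => ?_⟩
  obtain ⟨p, U, -, hp1, hU, hΦ⟩ := h
  have hk : ∀ k, (U k * X * (U k)ᴴ).trace = X.trace := fun k => by
    rw [Matrix.trace_mul_comm, ← Matrix.mul_assoc, ← Matrix.star_eq_conjTranspose,
      Matrix.mem_unitaryGroup_iff'.1 (hU k), Matrix.one_mul]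
  rw [hΦ, Matrix.trace_sum]
  simp only [Matrix.trace_smul, hk, ← Finset.sum_smul]
  rw [← Complex.ofReal_sum, hp1]
  simp

theorem HasMixedUnitaryDecomposition.conj {Φ Φ' : MatMap n n} {W : Matrix n n ℂ}
    (hWu : W ∈ Matrix.unitaryGroup n ℂ) (hW : ∀ X, Φ' X = W * Φ X * Wᴴ) {N : ℕ}
    (h : HasMixedUnitaryDecomposition Φ N) : HasMixedUnitaryDecomposition Φ' N := by
  obtain ⟨p, U, hp, hp1, hU, hΦ⟩ := h
  refine ⟨p, fun k => W * U k, hp, hp1, fun k => mul_mem hWu (hU k), fun X => ?_⟩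
  simp only [hW, hΦ, Matrix.mul_sum, Matrix.sum_mul, Matrix.conjTranspose_mul, Matrix.mul_assoc,
    Matrix.mul_smul, Matrix.smul_mul]

theorem conj_symm {Φ Φ' : MatMap n n} {W : Matrix n n ℂ}
    (hWu : W ∈ Matrix.unitaryGroup n ℂ) (hW : ∀ X, Φ' X = W * Φ X * Wᴴ) (X : Matrix n n ℂ) :
    Φ X = Wᴴ * Φ' X * Wᴴᴴ := by
  have h1 : Wᴴ * W = 1 := Matrix.mem_unitaryGroup_iff'.1 hWu
  rw [hW, Matrix.conjTranspose_conjTranspose]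
  simp only [Matrix.mul_assoc, h1, Matrix.mul_one]
  rw [← Matrix.mul_assoc, h1, Matrix.one_mul]

theorem hasKrausRepresentation_conj_iff {Φ Φ' : MatMap n n} {W : Matrix n n ℂ}
    (hWu : W ∈ Matrix.unitaryGroup n ℂ) (hW : ∀ X, Φ' X = W * Φ X * Wᴴ) {r : ℕ} :
    HasKrausRepresentation Φ' r ↔ HasKrausRepresentation Φ r :=
  ⟨.conj (conj_symm hWu hW), .conj hW⟩

theorem hasMixedUnitaryDecomposition_conj_iff {Φ Φ' : MatMap n n} {W : Matrix n n ℂ}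
    (hWu : W ∈ Matrix.unitaryGroup n ℂ) (hW : ∀ X, Φ' X = W * Φ X * Wᴴ) {N : ℕ} :
    HasMixedUnitaryDecomposition Φ' N ↔ HasMixedUnitaryDecomposition Φ N :=
  ⟨.conj (Unitary.star_mem hWu) (conj_symm hWu hW), .conj hWu hW⟩

/-! ### Schur maps -/

/-- A Kraus operator `Bₛ` of a Schur map enters `C` only through its diagonal; conversely, a
factorization `C = B B*` gives the diagonal Kraus operators made of the columns of `B`. -/
theorem hasKrausRepresentation_schurMap_iff {C : Matrix n n ℂ} {r : ℕ} :
    HasKrausRepresentation (schurMap C) r ↔ ∃ B : Matrix n (Fin r) ℂ, C = B * Bᴴ := by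
  constructor
  · rintro ⟨A, hA⟩
    -- the entry `(i, j)` of `C` is that of the image of the matrix unit `E_{ij}`
    refine ⟨Matrix.of fun i s => A s i i, ?_⟩
    ext i j
    have h := congrFun (congrFun (hA (Matrix.single i j 1)) i) j
    simp only [schurMap, LinearMap.coe_mk, AddHom.coe_mk, Matrix.hadamard_apply,
      Matrix.single_apply_same, mul_one, Matrix.sum_apply] at h
    rw [h]
    simp [Matrix.mul_apply, Matrix.single_apply, ite_and]
  · rintro ⟨B, rfl⟩
    refine ⟨fun s => Matrix.diagonal fun i => B i s, fun X => ?_⟩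
    ext i j
    simp only [schurMap, LinearMap.coe_mk, AddHom.coe_mk, Matrix.hadamard_apply, Matrix.mul_apply,
      Matrix.sum_apply, Matrix.diagonal_conjTranspose]
    simp [Matrix.diagonal_apply, Finset.sum_mul]
    exact Finset.sum_congr rfl fun s _ => by ring

theorem rank_le_of_hasKrausRepresentation_schurMap {C : Matrix n n ℂ} {r : ℕ}
    (h : HasKrausRepresentation (schurMap C) r) : C.rank ≤ r := by
  obtain ⟨B, rfl⟩ := hasKrausRepresentation_schurMap_iff.1 h
  exact (Matrix.rank_mul_le_left _ _).trans (B.rank_le_card_width.trans (by simp))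

theorem HasKrausRepresentation.schurMap_submatrix {n' : Type*} [Fintype n'] [DecidableEq n']
    {C : Matrix n n ℂ} {r : ℕ} (h : HasKrausRepresentation (schurMap C) r) (e : n' → n) :
    HasKrausRepresentation (schurMap (C.submatrix e e)) r := by
  obtain ⟨B, rfl⟩ := hasKrausRepresentation_schurMap_iff.1 h
  exact hasKrausRepresentation_schurMap_iff.2 ⟨B.submatrix e id, rfl⟩

/-- The unitaries of a mixed-unitary decomposition of a Schur map that have positive weight are
diagonal, since the diagonal matrix units are mapped to multiples of themselves. -/
theorem hasMixedUnitaryDecomposition_schurMap_iff {C : Matrix n n ℂ} {N : ℕ} :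
    HasMixedUnitaryDecomposition (schurMap C) N ↔ HasToroidalDecomposition C N := by
  constructor
  · rintro ⟨p, U, hp, hp1, hU, hΦ⟩
    have hentry : ∀ i j a b, (schurMap C (Matrix.single i j 1)) a b
        = ∑ k, (p k : ℂ) * (U k a i * star (U k b j)) := by
      intro i j a b
      rw [hΦ]
      simp [Matrix.sum_apply, Matrix.mul_apply, Matrix.single_apply, ite_and]
    have hdiag : ∀ k, p k ≠ 0 → ∀ i j, i ≠ j → U k i j = 0 := by
      intro k hk i j hij
      have h := hentry j j i i
      have h0 : (schurMap C (Matrix.single j j 1)) i i = 0 := by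
        simp [schurMap, hij.symm]
      rw [h0] at h
      have h' : ∑ k, p k * ‖U k i j‖ ^ 2 = 0 := by
        have : ((∑ k, p k * ‖U k i j‖ ^ 2 : ℝ) : ℂ) = 0 := by
          rw [h]; push_cast
          refine Finset.sum_congr rfl fun k _ => ?_
          rw [← Complex.mul_conj']; rfl
        exact_mod_cast this
      have := (Finset.sum_eq_zero_iff_of_nonneg
        (fun k _ => mul_nonneg (hp k) (sq_nonneg _))).1 h' k (Finset.mem_univ _)
      simpa [hk] using this
    -- the terms of weight zero are replaced by the all-ones vector
    refine ⟨p, fun k i => if p k = 0 then 1 else U k i i, hp, hp1, fun k i => ?_, ?_⟩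
    · by_cases hk : p k = 0
      · simp [hk]
      · have h := congrFun (congrFun (Matrix.mem_unitaryGroup_iff.1 (hU k)) i) i
        rw [Matrix.mul_apply, Finset.sum_eq_single i
          (fun j _ hj => by rw [hdiag k hk i j hj.symm, zero_mul]) (by simp)] at h
        simp only [Matrix.star_apply, Matrix.one_apply_eq] at h
        have h2 : ((‖U k i i‖ ^ 2 : ℝ) : ℂ) = 1 := by
          rw [← h]; push_cast; rw [← Complex.mul_conj']; rfl
        have h3 : ‖U k i i‖ ^ 2 = 1 := by exact_mod_cast h2
        simpa [hk] using (pow_eq_one_iff_of_nonneg (norm_nonneg _) two_ne_zero).1 h3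
    · ext i j
      have h := hentry i j i j
      simp only [schurMap, LinearMap.coe_mk, AddHom.coe_mk, Matrix.hadamard_apply,
        Matrix.single_apply_same, mul_one] at h
      rw [h, Matrix.sum_apply]
      refine Finset.sum_congr rfl fun k _ => ?_
      by_cases hk : p k = 0 <;> simp [hk, Matrix.vecMulVec_apply]
  · rintro ⟨p, w, hp, hp1, hw, rfl⟩
    refine ⟨p, fun k => Matrix.diagonal (w k), hp, hp1, fun k => ?_, fun X => ?_⟩
    · rw [Matrix.mem_unitaryGroup_iff, Matrix.star_eq_conjTranspose, Matrix.diagonal_conjTranspose,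
        Matrix.diagonal_mul_diagonal, ← Matrix.diagonal_one]
      congr 1
      ext i
      simp [Complex.mul_conj', hw]
    · ext i j
      simp only [schurMap, LinearMap.coe_mk, AddHom.coe_mk, Matrix.hadamard_apply,
        Matrix.sum_apply, Matrix.diagonal_conjTranspose, Matrix.smul_apply, Finset.sum_mul]
      refine Finset.sum_congr rfl fun k _ => ?_
      simp [Matrix.mul_apply, Matrix.diagonal_apply, Matrix.vecMulVec_apply]
      ring

theorem rank_le_of_hasToroidalDecomposition {C : Matrix n n ℂ} {N : ℕ}
    (h : HasToroidalDecomposition C N) : C.rank ≤ N :=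
  rank_le_of_hasKrausRepresentation_schurMap
    (hasMixedUnitaryDecomposition_schurMap_iff.2 h).hasKrausRepresentation

/-- The operator system consists of the diagonal matrices whose diagonal is in the range of
`C̄ ⊙ C`, because `Φ*Φ` is the Schur map of `C̄ ⊙ C`. -/
theorem finrank_operatorSystem_schurMap (C : Matrix n n ℂ) :
    Module.finrank ℂ (operatorSystem (schurMap C)) = (C.map star ⊙ C).rank := by
  have hadj : (adjointMap (schurMap C)).comp (schurMap C) = schurMap (C.map star ⊙ C) := by
    refine LinearMap.ext fun X => ?_
    ext j k
    simp [adjointMap, schurMap, Matrix.trace, Matrix.mul_apply, Matrix.single_apply, ite_and,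
      apply_ite (starRingEnd ℂ), mul_assoc]
  have hchoi : ∀ (D : Matrix n n ℂ) (x : n × n → ℂ) (a b : n),
      (choiMatrix (schurMap D)).mulVec x (a, b)
        = if a = b then D.mulVec (fun k => x (k, k)) a else 0 := by
    intro D x a b
    have hJ : ∀ c e, choiMatrix (schurMap D) (a, b) (c, e)
        = if a = b ∧ c = e then D a c else 0 := by
      intro c e
      simp only [choiMatrix, Matrix.sum_apply, Matrix.kroneckerMap_apply, schurMap,
        LinearMap.coe_mk, AddHom.coe_mk, Matrix.hadamard_apply, Matrix.single_apply]
      rw [Finset.sum_eq_single a (fun j _ hj => Finset.sum_eq_zero fun k _ => by simp [hj])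
        (by simp), Finset.sum_eq_single c (fun k _ hk => by simp [hk]) (by simp)]
      simp only [and_self, if_true]
      split_ifs <;> simp
    simp only [Matrix.mulVec, dotProduct, Fintype.sum_prod_type, hJ]
    split_ifs with hab <;> simp [hab]
  have hrange : operatorSystem (schurMap C)
      = (LinearMap.range (C.map star ⊙ C).mulVecLin).map (Matrix.diagonalLinearMap n ℂ ℂ) := by
    unfold operatorSystem
    rw [hadj]
    ext X
    simp only [Submodule.mem_comap, LinearMap.mem_range, Submodule.mem_map,
      Matrix.mulVecLin_apply]
    constructor
    · rintro ⟨x, hx⟩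
      refine ⟨_, ⟨fun k => x (k, k), rfl⟩, ?_⟩
      ext a b
      have h := congrFun hx (a, b)
      rw [hchoi] at h
      exact (Matrix.diagonal_apply _ _ _).trans h
    · rintro ⟨_, ⟨y, rfl⟩, rfl⟩
      refine ⟨fun p => y p.1, ?_⟩
      ext ⟨a, b⟩
      rw [hchoi]
      exact (Matrix.diagonal_apply _ _ _).symm
  rw [hrange]
  exact ((Submodule.equivMapOfInjective _ Matrix.diagonal_injective _).finrank_eq).symm

end General

section Bases

/-! ### Gram matrices of the projections of mutually unbiased bases -/

/-- The Gram matrix of the `N d` rank-one projections onto the vectors of `N` mutually unbiased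
bases of `ℂ^d`, for the inner product `Tr(P* Q)`: identity blocks on the diagonal, and
all entries `1 / d` in the other blocks. -/
noncomputable def unbiasedGram (N d : ℕ) : Matrix (Fin N × Fin d) (Fin N × Fin d) ℂ :=
  Matrix.of fun p q => if p.1 = q.1 then (if p.2 = q.2 then 1 else 0) else 1 / (d : ℂ)

theorem unbiasedGram_mulVec {N d : ℕ} (x : Fin N × Fin d → ℂ) (k : Fin N) (j : Fin d) :
    (unbiasedGram N d *ᵥ x) (k, j)
      = x (k, j) + (1 / d) * (∑ q, x q - ∑ i, x (k, i)) := by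
  have hk : ∀ k', ∑ i, unbiasedGram N d (k, j) (k', i) * x (k', i)
      = (1 / d) * ∑ i, x (k', i) + if k = k' then x (k, j) - (1 / d) * ∑ i, x (k, i) else 0 := by
    intro k'
    by_cases h : k = k'
    · subst h
      simp [unbiasedGram]
    · simp [unbiasedGram, h, Finset.mul_sum]
  simp only [Matrix.mulVec, dotProduct, Fintype.sum_prod_type, hk, Finset.sum_add_distrib,
    Finset.sum_ite_eq, Finset.mem_univ, if_true, ← Finset.mul_sum]
  ring

/-- The kernel consists of the vectors that are constant `cₖ` on the `k`-th block, with
`∑ₖ cₖ = 0`. -/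
theorem rank_unbiasedGram {N d : ℕ} (hN : 0 < N) (hd : 0 < d) :
    (unbiasedGram N d).rank + (N - 1) = N * d := by
  have hd' : (d : ℂ) ≠ 0 := by exact_mod_cast hd.ne'
  have : Nonempty (Fin N) := ⟨⟨0, hN⟩⟩
  let j₀ : Fin d := ⟨0, hd⟩
  let L : (Fin N → ℂ) →ₗ[ℂ] (Fin N × Fin d → ℂ) := LinearMap.funLeft ℂ ℂ Prod.fst
  let S : (Fin N → ℂ) →ₗ[ℂ] ℂ := ∑ k, LinearMap.proj k
  have hS : ∀ c, S c = ∑ k, c k := fun c => by simp [S]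
  have hL : Function.Injective L := fun c c' h => funext fun k => congrFun h (k, j₀)
  have hker : LinearMap.ker (unbiasedGram N d).mulVecLin = (LinearMap.ker S).map L := by
    ext x
    simp only [LinearMap.mem_ker, Submodule.mem_map, Matrix.mulVecLin_apply]
    constructor
    · intro hx
      have h1 : ∀ k j, x (k, j) + (1 / d) * (∑ q, x q - ∑ i, x (k, i)) = 0 := fun k j => by
        rw [← unbiasedGram_mulVec, hx]; rfl
      have hconst : ∀ k j, x (k, j) = x (k, j₀) := fun k j => by
        linear_combination h1 k j - h1 k j₀
      refine ⟨fun k => x (k, j₀), ?_, ?_⟩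
      · have h2 := h1 ⟨0, hN⟩ j₀
        have h3 : ∑ i, x (⟨0, hN⟩, i) = d * x (⟨0, hN⟩, j₀) := by
          simp [hconst _ _]
        have h4 : ∑ q, x q = d * ∑ k, x (k, j₀) := by
          rw [Fintype.sum_prod_type, Finset.mul_sum]
          refine Finset.sum_congr rfl fun k _ => ?_
          rw [Finset.sum_congr rfl fun i _ => hconst k i]
          simp
        rw [h3, h4] at h2
        rw [hS]
        field_simp at h2
        linear_combination h2
      · ext ⟨k, j⟩
        exact (hconst k j).symm
    · rintro ⟨c, hc, rfl⟩
      rw [hS] at hc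
      ext ⟨k, j⟩
      rw [unbiasedGram_mulVec]
      have h4 : ∑ q, L c q = d * ∑ k, c k := by
        rw [Fintype.sum_prod_type, Finset.mul_sum]
        simp [L, LinearMap.funLeft_apply]
      rw [h4, hc]
      simp [L, LinearMap.funLeft_apply, hd']
  have hSr : Module.finrank ℂ (LinearMap.range S) = 1 := by
    rw [LinearMap.range_eq_top.2, finrank_top, Module.finrank_self]
    intro a
    exact ⟨Pi.single ⟨0, hN⟩ a, by rw [hS]; simp⟩
  have e1 := LinearMap.finrank_range_add_finrank_ker S
  have e2 := LinearMap.finrank_range_add_finrank_ker (unbiasedGram N d).mulVecLin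
  rw [hker, ← (Submodule.equivMapOfInjective L hL _).finrank_eq] at e2
  simp only [Module.finrank_fintype_fun_eq_card, Fintype.card_prod, Fintype.card_fin] at e1 e2
  rw [Matrix.rank]
  omega

/-! ### Orthonormal bases and rank-one matrices -/

variable {d : ℕ}

theorem star_dotProduct_eq_inner (x y : EuclideanSpace ℂ (Fin d)) :
    star x.ofLp ⬝ᵥ y.ofLp = inner ℂ x y := by
  rw [EuclideanSpace.inner_eq_star_dotProduct, dotProduct_comm]

theorem star_dotProduct_vecMulVec_mulVec (w f g z : EuclideanSpace ℂ (Fin d)) :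
    star w.ofLp ⬝ᵥ (Matrix.vecMulVec f.ofLp (star g.ofLp) *ᵥ z.ofLp)
      = inner ℂ w f * inner ℂ g z := by
  rw [Matrix.vecMulVec_mulVec, star_dotProduct_eq_inner]
  simp [star_dotProduct_eq_inner, mul_comm]

theorem inner_mul_inner_swap (x y : EuclideanSpace ℂ (Fin d)) :
    inner ℂ x y * inner ℂ y x = ((‖inner ℂ x y‖ ^ 2 : ℝ) : ℂ) := by
  rw [← inner_conj_symm y x, Complex.mul_conj']
  norm_cast

theorem sum_apply_mul_star_apply (b : OrthonormalBasis (Fin d) ℂ (EuclideanSpace ℂ (Fin d)))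
    (i i' : Fin d) : ∑ j, b j i * star (b j i') = if i = i' then 1 else 0 := by
  have h := b.sum_inner_mul_inner (EuclideanSpace.single i 1) (EuclideanSpace.single i' 1)
  simpa [EuclideanSpace.inner_single_left, EuclideanSpace.inner_single_right, eq_comm,
    Pi.single_apply] using h

variable {N : ℕ} {u : Fin N → OrthonormalBasis (Fin d) ℂ (EuclideanSpace ℂ (Fin d))}

theorem MutuallyUnbiased.inner_mul_inner_eq_unbiasedGram (hu : MutuallyUnbiased u)
    (p q : Fin N × Fin d) :
    inner ℂ (u p.1 p.2) (u q.1 q.2) * inner ℂ (u q.1 q.2) (u p.1 p.2) = unbiasedGram N d p q := by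
  obtain ⟨t, j⟩ := p
  obtain ⟨s, i⟩ := q
  by_cases h : t = s
  · subst h
    by_cases hij : j = i
    · subst hij
      simp [unbiasedGram]
    · simp [unbiasedGram, hij, OrthonormalBasis.inner_eq_zero _ hij]
  · rw [inner_mul_inner_swap, hu t s h, div_pow, Real.sq_sqrt (Nat.cast_nonneg d)]
    simp [unbiasedGram, h]

/-- A complete set of `d + 1` mutually unbiased bases is informationally complete: a matrix `T`
is determined by the numbers `⟨w, T w⟩`, for `w` in the bases. The matrix of this linear map has
`unbiasedGram (d + 1) d` as its product with its adjoint, so it has rank `d²`. -/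
theorem MutuallyUnbiased.eq_zero_of_forall_dotProduct_mulVec_eq_zero (hd : 0 < d)
    {u : Fin (d + 1) → OrthonormalBasis (Fin d) ℂ (EuclideanSpace ℂ (Fin d))}
    (hu : MutuallyUnbiased u) {T : Matrix (Fin d) (Fin d) ℂ}
    (hT : ∀ t j, star (u t j).ofLp ⬝ᵥ (T *ᵥ (u t j).ofLp) = 0) : T = 0 := by
  let B : Matrix (Fin (d + 1) × Fin d) (Fin d × Fin d) ℂ :=
    Matrix.of fun p q => star (u p.1 p.2 q.1) * u p.1 p.2 q.2
  have hB : B * Bᴴ = unbiasedGram (d + 1) d := by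
    ext p q
    rw [← hu.inner_mul_inner_eq_unbiasedGram, ← star_dotProduct_eq_inner,
      ← star_dotProduct_eq_inner, dotProduct, dotProduct, Finset.sum_mul_sum, Matrix.mul_apply,
      Fintype.sum_prod_type]
    refine Finset.sum_congr rfl fun a _ => Finset.sum_congr rfl fun b _ => ?_
    simp [B]
    ring
  have hr := rank_unbiasedGram (Nat.succ_pos d) hd
  rw [← hB, Matrix.rank_self_mul_conjTranspose, Matrix.rank] at hr
  have e := LinearMap.finrank_range_add_finrank_ker B.mulVecLin
  simp only [Module.finrank_fintype_fun_eq_card, Fintype.card_prod, Fintype.card_fin] at e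
  have hk : Module.finrank ℂ (LinearMap.ker B.mulVecLin) = 0 := by
    simp only [Nat.succ_eq_add_one, Nat.add_sub_cancel, Nat.add_mul, Nat.one_mul] at hr
    omega
  have hmem : (fun q : Fin d × Fin d => T q.1 q.2) ∈ LinearMap.ker B.mulVecLin := by
    rw [LinearMap.mem_ker, Matrix.mulVecLin_apply]
    ext ⟨t, j⟩
    rw [Pi.zero_apply, ← hT t j]
    simp only [Matrix.mulVec, dotProduct, Fintype.sum_prod_type, B, Matrix.of_apply,
      Finset.mul_sum]
    refine Finset.sum_congr rfl fun a _ => Finset.sum_congr rfl fun b _ => ?_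
    simp
    ring
  rw [Submodule.finrank_eq_zero.1 hk, Submodule.mem_bot] at hmem
  ext a b
  exact congrFun hmem (a, b)

/-- A vector unbiased to the first `d` of `d + 1` mutually unbiased bases is a multiple of a vector
of the last one: at most one of its coordinates in that basis is nonzero.
By informational completeness `y y* = ∑ₗ |⟨vₗ, y⟩|² vₗ vₗ*`, where `v` is the last basis. -/
theorem MutuallyUnbiased.inner_last_mul_inner_last_eq_zero (hd : 0 < d)
    {u : Fin (d + 1) → OrthonormalBasis (Fin d) ℂ (EuclideanSpace ℂ (Fin d))}
    (hu : MutuallyUnbiased u) {y : EuclideanSpace ℂ (Fin d)}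
    (hy : ∀ (t : Fin d) j, ‖inner ℂ (u t.castSucc j) y‖ = 1) {l m : Fin d} (hlm : l ≠ m) :
    inner ℂ (u (Fin.last d) l) y * inner ℂ y (u (Fin.last d) m) = 0 := by
  set v := u (Fin.last d) with hv
  let T : Matrix (Fin d) (Fin d) ℂ := Matrix.vecMulVec y.ofLp (star y.ofLp)
    - ∑ k, ((‖inner ℂ (v k) y‖ ^ 2 : ℝ) : ℂ) • Matrix.vecMulVec (v k).ofLp (star (v k).ofLp)
  have hTq : ∀ w z : EuclideanSpace ℂ (Fin d), star w.ofLp ⬝ᵥ (T *ᵥ z.ofLp)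
      = inner ℂ w y * inner ℂ y z
        - ∑ k, ((‖inner ℂ (v k) y‖ ^ 2 : ℝ) : ℂ) * (inner ℂ w (v k) * inner ℂ (v k) z) := by
    intro w z
    simp only [T, Matrix.sub_mulVec, dotProduct_sub, Matrix.sum_mulVec, dotProduct_sum,
      Matrix.smul_mulVec, dotProduct_smul, star_dotProduct_vecMulVec_mulVec, smul_eq_mul]
  have hy2 : ∑ k, ‖inner ℂ (v k) y‖ ^ 2 = d := by
    rw [v.sum_sq_norm_inner_right, ← (u (Fin.castSucc ⟨0, hd⟩)).sum_sq_norm_inner_right]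
    simp only [hy]
    simp
  have hd' : (d : ℂ) ≠ 0 := by exact_mod_cast hd.ne'
  have hT0 : T = 0 := by
    refine hu.eq_zero_of_forall_dotProduct_mulVec_eq_zero hd fun t j => ?_
    rw [hTq, inner_mul_inner_swap]
    rcases Fin.eq_castSucc_or_eq_last t with ⟨s, rfl⟩ | rfl
    · have hk : ∀ k, inner ℂ (u s.castSucc j) (v k) * inner ℂ (v k) (u s.castSucc j)
          = 1 / (d : ℂ) := fun k => by
        have := hu.inner_mul_inner_eq_unbiasedGram (s.castSucc, j) (Fin.last d, k)
        rw [hv, this]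
        simp [unbiasedGram, (Fin.castSucc_lt_last s).ne]
      simp only [hk]
      rw [← Finset.sum_mul, ← Complex.ofReal_sum, hy2, hy]
      simp [hd']
    · rw [← hv, Finset.sum_eq_single j]
      · simp
      · intro k _ hk
        rw [v.inner_eq_zero hk.symm]
        simp
      · simp
  have h := hTq (v l) (v m)
  rw [hT0, Finset.sum_eq_zero, Matrix.zero_mulVec, dotProduct_zero, sub_zero] at h
  · exact h.symm
  · intro k _
    by_cases hk : l = k
    · rw [v.inner_eq_zero (i := k) (j := m) (hk ▸ hlm)]
      simp
    · rw [v.inner_eq_zero hk]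
      simp

end Bases

section Correlation

/-! ### The matrix `C` -/

variable {d : ℕ} {u : Fin (d + 1) → OrthonormalBasis (Fin d) ℂ (EuclideanSpace ℂ (Fin d))}

theorem mubMatrix_mulVec (y : EuclideanSpace ℂ (Fin d)) (p : Fin d × Fin d) :
    (mubMatrix u *ᵥ y.ofLp) p = inner ℂ (u p.1.castSucc p.2) y :=
  star_dotProduct_eq_inner _ _

theorem mubCorrelation_apply (p q : Fin d × Fin d) :
    mubCorrelation u p q = inner ℂ (u p.1.castSucc p.2) (u q.1.castSucc q.2) := by
  rw [← star_dotProduct_eq_inner]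
  simp [mubCorrelation, mubMatrix, Matrix.mul_apply, dotProduct]

theorem conjTranspose_mubMatrix_mul_mubMatrix :
    (mubMatrix u)ᴴ * mubMatrix u = (d : ℂ) • (1 : Matrix (Fin d) (Fin d) ℂ) := by
  ext i i'
  simp only [Matrix.mul_apply, Fintype.sum_prod_type, mubMatrix, Matrix.conjTranspose_apply,
    Matrix.of_apply, star_star, sum_apply_mul_star_apply]
  simp [Matrix.one_apply]

theorem mubCorrelation_map_star_hadamard (hu : MutuallyUnbiased u) :
    (mubCorrelation u).map star ⊙ mubCorrelation u = unbiasedGram d d := by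
  ext p q
  have h := hu.inner_mul_inner_eq_unbiasedGram (p.1.castSucc, p.2) (q.1.castSucc, q.2)
  rw [Matrix.hadamard_apply, Matrix.map_apply, mubCorrelation_apply, Complex.star_def,
    inner_conj_symm, mul_comm, h]
  simp [unbiasedGram]

/-- The vector `√d A v` of entries `√d ⟨u_{k,j}, v⟩`. -/
noncomputable def phaseVector
    (u : Fin (d + 1) → OrthonormalBasis (Fin d) ℂ (EuclideanSpace ℂ (Fin d)))
    (l : Fin d) (p : Fin d × Fin d) : ℂ :=
  (Real.sqrt d : ℂ) * inner ℂ (u p.1.castSucc p.2) (u (Fin.last d) l)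

theorem norm_phaseVector (hd : 0 < d) (hu : MutuallyUnbiased u) (l : Fin d) (p : Fin d × Fin d) :
    ‖phaseVector u l p‖ = 1 := by
  have : Real.sqrt d ≠ 0 := (Real.sqrt_pos.2 (by exact_mod_cast hd)).ne'
  rw [phaseVector, norm_mul, hu _ _ (Fin.castSucc_lt_last _).ne, Complex.norm_real,
    Real.norm_of_nonneg (Real.sqrt_nonneg _), mul_one_div_cancel this]

theorem sum_phaseVector_mul_star (p q : Fin d × Fin d) :
    ∑ l, phaseVector u l p * star (phaseVector u l q) = d * mubCorrelation u p q := by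
  rw [mubCorrelation_apply, ← (u (Fin.last d)).sum_inner_mul_inner, Finset.mul_sum]
  refine Finset.sum_congr rfl fun l _ => ?_
  have hs : (Real.sqrt d : ℂ) * (Real.sqrt d : ℂ) = d := by
    rw [← Complex.ofReal_mul, Real.mul_self_sqrt (Nat.cast_nonneg d), Complex.ofReal_natCast]
  rw [phaseVector, phaseVector, star_mul', Complex.star_def, inner_conj_symm,
    Complex.conj_ofReal, ← hs]
  ring

theorem hasToroidalDecomposition_mubCorrelation (hd : 0 < d) (hu : MutuallyUnbiased u) :
    HasToroidalDecomposition (mubCorrelation u) d := by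
  have hd' : (d : ℝ) ≠ 0 := by exact_mod_cast hd.ne'
  have hd'' : (d : ℂ) ≠ 0 := by exact_mod_cast hd.ne'
  refine ⟨fun _ => 1 / d, phaseVector u, fun _ => by positivity, by simp [hd'],
    norm_phaseVector hd hu, ?_⟩
  ext p q
  simp only [Matrix.sum_apply, Matrix.smul_apply, Matrix.vecMulVec_apply, Pi.star_apply,
    smul_eq_mul, ← Finset.mul_sum, sum_phaseVector_mul_star]
  push_cast
  field_simp

theorem rank_mubCorrelation (hd : 0 < d) : (mubCorrelation u).rank = d := by
  have hd'' : (d : ℂ) ≠ 0 := by exact_mod_cast hd.ne'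
  rw [mubCorrelation, Matrix.rank_self_mul_conjTranspose, ← Matrix.rank_conjTranspose_mul_self,
    conjTranspose_mubMatrix_mul_mubMatrix, Matrix.rank_of_det_ne_zero (by simp [hd''])]
  simp

theorem isCorrelationMatrix_mubCorrelation : IsCorrelationMatrix (mubCorrelation u) :=
  ⟨Matrix.posSemidef_self_mul_conjTranspose _, fun p => by simp [mubCorrelation_apply]⟩

/-! ### The matrix `C ⊕ J` -/

theorem of_one_fin_one : (Matrix.of fun _ _ => 1 : Matrix (Fin 1) (Fin 1) ℂ) = 1 := by
  ext i j
  rw [Subsingleton.elim i j, Matrix.one_apply_eq, Matrix.of_apply]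

/-- The direct sum `C ⊕ J` of `C` and the all-ones matrix `J` of size `m`. -/
noncomputable def mubCorrelationSum
    (u : Fin (d + 1) → OrthonormalBasis (Fin d) ℂ (EuclideanSpace ℂ (Fin d))) (m : Type*) :
    Matrix ((Fin d × Fin d) ⊕ m) ((Fin d × Fin d) ⊕ m) ℂ :=
  Matrix.fromBlocks (mubCorrelation u) 0 0 (Matrix.of fun _ _ => 1)

theorem mubCorrelationSum_fin_one :
    mubCorrelationSum u (Fin 1) = Matrix.fromBlocks (mubCorrelation u) 0 0 1 := by
  rw [mubCorrelationSum, of_one_fin_one]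

theorem mubCorrelationSum_submatrix (m : Type*) (i : m) :
    (mubCorrelationSum u m).submatrix (Sum.map id fun _ => i) (Sum.map id fun _ => i)
      = mubCorrelationSum u (Fin 1) := by
  ext (p | p) (q | q) <;> rfl

/-- A factorization `C ⊕ J = B B*` with `d + 1` columns, `B = A ⊕ (1, …, 1)ᵀ`. -/
theorem mubCorrelationSum_eq_mul_conjTranspose (m : Type*) :
    mubCorrelationSum u m
      = Matrix.fromBlocks (mubMatrix u) 0 0 (Matrix.of fun _ _ => 1 : Matrix m (Fin 1) ℂ)
        * (Matrix.fromBlocks (mubMatrix u) 0 0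
            (Matrix.of fun _ _ => 1 : Matrix m (Fin 1) ℂ))ᴴ := by
  rw [Matrix.fromBlocks_conjTranspose, Matrix.fromBlocks_multiply, mubCorrelationSum]
  congr 1
  · simp [mubCorrelation]
  · simp
  · simp
  · ext i j
    simp [Matrix.mul_apply]

theorem isCorrelationMatrix_mubCorrelationSum (m : Type*) [Finite m] :
    IsCorrelationMatrix (mubCorrelationSum u m) := by
  refine ⟨?_, ?_⟩
  · rw [mubCorrelationSum_eq_mul_conjTranspose]
    exact Matrix.posSemidef_self_mul_conjTranspose _
  · rintro (p | p)
    · exact isCorrelationMatrix_mubCorrelation.2 p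
    · rfl

theorem rank_mubCorrelationSum_fin_one (hd : 0 < d) :
    (mubCorrelationSum u (Fin 1)).rank = d + 1 := by
  have hd'' : (d : ℂ) ≠ 0 := by exact_mod_cast hd.ne'
  rw [mubCorrelationSum_eq_mul_conjTranspose, Matrix.rank_self_mul_conjTranspose,
    ← Matrix.rank_conjTranspose_mul_self, Matrix.fromBlocks_conjTranspose,
    Matrix.fromBlocks_multiply]
  simp only [Matrix.conjTranspose_zero, Matrix.mul_zero, Matrix.zero_mul, add_zero, zero_add,
    conjTranspose_mubMatrix_mul_mubMatrix, of_one_fin_one, Matrix.conjTranspose_one, Matrix.mul_one]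
  rw [Matrix.rank_of_det_ne_zero]
  · simp
  · simp [hd'']

theorem HasToroidalDecomposition.submatrix {n n' : Type*} {C : Matrix n n ℂ} {N : ℕ}
    (h : HasToroidalDecomposition C N) (e : n' → n) :
    HasToroidalDecomposition (C.submatrix e e) N := by
  obtain ⟨p, w, hp, hp1, hw, rfl⟩ := h
  refine ⟨p, fun k i => w k (e i), hp, hp1, fun k i => hw k (e i), ?_⟩
  ext i j
  simp [Matrix.sum_apply, Matrix.vecMulVec_apply]

theorem hasKrausRepresentation_schurMap_mubCorrelationSum (m : Type*) [Fintype m]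
    [DecidableEq m] : HasKrausRepresentation (schurMap (mubCorrelationSum u m)) (d + 1) := by
  refine hasKrausRepresentation_schurMap_iff.2 ⟨Matrix.submatrix
    (Matrix.fromBlocks (mubMatrix u) 0 0 (Matrix.of fun _ _ => 1 : Matrix m (Fin 1) ℂ)) id
    finSumFinEquiv.symm, ?_⟩
  rw [Matrix.conjTranspose_submatrix, Matrix.submatrix_mul_equiv, Matrix.submatrix_id_id,
    ← mubCorrelationSum_eq_mul_conjTranspose]

theorem hasKrausRepresentation_schurMap_mubCorrelation :
    HasKrausRepresentation (schurMap (mubCorrelation u)) d :=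
  hasKrausRepresentation_schurMap_iff.2 ⟨mubMatrix u, rfl⟩

theorem le_of_hasKrausRepresentation_mubCorrelationSum (hd : 0 < d) {m : Type*} [Fintype m]
    [DecidableEq m] [Nonempty m] {r : ℕ}
    (h : HasKrausRepresentation (schurMap (mubCorrelationSum u m)) r) : d + 1 ≤ r := by
  obtain ⟨i⟩ := ‹Nonempty m›
  have h' := h.schurMap_submatrix (Sum.map id fun _ : Fin 1 => i)
  rw [mubCorrelationSum_submatrix] at h'
  rw [← rank_mubCorrelationSum_fin_one (u := u) hd]
  exact rank_le_of_hasKrausRepresentation_schurMap h'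

/-- The decomposition of `C` into `d` terms `w w* / d` gives one of `C ⊕ J` into the `2 d` terms
`(w ⊕ ±1)(w ⊕ ±1)* / (2 d)`. -/
theorem hasToroidalDecomposition_mubCorrelationSum (hd : 0 < d) (hu : MutuallyUnbiased u)
    (m : Type*) : HasToroidalDecomposition (mubCorrelationSum u m) (2 * d) := by
  have hd' : (d : ℝ) ≠ 0 := by exact_mod_cast hd.ne'
  have hd'' : (d : ℂ) ≠ 0 := by exact_mod_cast hd.ne'
  let s : Fin 2 → ℂ := ![1, -1]
  have hs : ∀ i, ‖s i‖ = 1 := by intro i; fin_cases i <;> simp [s]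
  have key : ∀ f : Fin 2 × Fin d → ℂ, ∑ k : Fin (2 * d), f (finProdFinEquiv.symm k)
      = ∑ l, (f (0, l) + f (1, l)) := fun f => by
    rw [Equiv.sum_comp, Fintype.sum_prod_type, Fin.sum_univ_two, Finset.sum_add_distrib]
  refine ⟨fun _ => 1 / (2 * d), fun k => Sum.elim (phaseVector u (finProdFinEquiv.symm k).2)
    fun _ => s (finProdFinEquiv.symm k).1, fun _ => by positivity, ?_, ?_, ?_⟩
  · simp
    field_simp
  · rintro k (p | p)
    · exact norm_phaseVector hd hu _ _
    · exact hs _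
  · ext i j
    simp only [Matrix.sum_apply, Matrix.smul_apply, Matrix.vecMulVec_apply, Pi.star_apply,
      smul_eq_mul, ← Finset.mul_sum]
    rw [key fun q => Sum.elim (phaseVector u q.2) (fun _ => s q.1) i
      * star (Sum.elim (phaseVector u q.2) (fun _ => s q.1) j)]
    rcases i with p | p <;> rcases j with q | q
    · simp only [Sum.elim_inl, Finset.sum_add_distrib, sum_phaseVector_mul_star,
        mubCorrelationSum, Matrix.fromBlocks_apply₁₁]
      push_cast
      field_simp
      ring
    · simp [mubCorrelationSum, s]
    · simp [mubCorrelationSum, s]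
    · simp [mubCorrelationSum, s]
      field_simp
      norm_num

end Correlation

section LowerBound

/-! ### The lower bound `2 d` -/

theorem vecMulVec_mulVec_star_mulVec {n m : Type*} [Fintype n] (M : Matrix m n ℂ) (x : n → ℂ) :
    Matrix.vecMulVec (M *ᵥ x) (star (M *ᵥ x)) = M * Matrix.vecMulVec x (star x) * Mᴴ := by
  rw [Matrix.star_mulVec, Matrix.mul_vecMulVec, Matrix.vecMulVec_mul]

/-- The terms of a convex combination of rank-one matrices lie in the range of the sum. -/
theorem mulVec_eq_zero_of_sum_vecMulVec {n m ι : Type*} [Fintype n] [Fintype ι]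
    {C : Matrix n n ℂ} {Q : Matrix m n ℂ} (hQ : Q * C = 0) {p : ι → ℝ} (hp : ∀ k, 0 ≤ p k)
    {x : ι → n → ℂ} (hC : C = ∑ k, (p k : ℂ) • Matrix.vecMulVec (x k) (star (x k)))
    {k : ι} (hk : p k ≠ 0) : Q *ᵥ x k = 0 := by
  have h : ∑ k, (p k : ℂ) • Matrix.vecMulVec (Q *ᵥ x k) (star (Q *ᵥ x k)) = 0 := by
    have : Q * C * Qᴴ = 0 := by rw [hQ, Matrix.zero_mul]
    rw [hC] at this
    simpa only [vecMulVec_mulVec_star_mulVec, Matrix.mul_sum, Matrix.sum_mul, Matrix.mul_smul,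
      Matrix.smul_mul] using this
  ext i
  have hi := congrFun (congrFun h i) i
  have h' : ∑ k, p k * ‖(Q *ᵥ x k) i‖ ^ 2 = 0 := by
    have : ((∑ k, p k * ‖(Q *ᵥ x k) i‖ ^ 2 : ℝ) : ℂ) = 0 := by
      rw [Matrix.sum_apply] at hi
      refine Eq.trans ?_ hi
      push_cast
      refine Finset.sum_congr rfl fun k _ => ?_
      rw [← Complex.mul_conj']
      rfl
    exact_mod_cast this
  have := (Finset.sum_eq_zero_iff_of_nonneg
    (fun k _ => mul_nonneg (hp k) (sq_nonneg _))).1 h' k (Finset.mem_univ _)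
  simpa [hk] using this

/-- If `∑ₖ pₖ |cₖₗ|² ≠ 0` and `∑ₖ pₖ αₖ cₖₗ = 0` for each `l`, with `αₖ ≠ 0`, and each
`k` of nonzero weight has at most one nonzero `cₖₗ`, then each `l` has its own two indices `k`
with `pₖ cₖₗ ≠ 0`. -/
theorem two_mul_card_le {κ ι : Type*} [Fintype κ] [Fintype ι] [DecidableEq κ]
    (p α : κ → ℂ) (c : κ → ι → ℂ) (hα : ∀ k, α k ≠ 0)
    (hc : ∀ k, p k ≠ 0 → ∀ l m, l ≠ m → c k l = 0 ∨ c k m = 0)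
    (hsq : ∀ l, ∑ k, p k * (c k l * star (c k l)) ≠ 0)
    (hsum : ∀ l, ∑ k, p k * (α k * c k l) = 0) : 2 * Fintype.card ι ≤ Fintype.card κ := by
  classical
  let S : ι → Finset κ := fun l => Finset.univ.filter fun k => p k ≠ 0 ∧ c k l ≠ 0
  have hdisj : ((Finset.univ : Finset ι) : Set ι).PairwiseDisjoint S := by
    intro l _ m _ hlm
    refine Finset.disjoint_left.2 fun k hk hk' => ?_
    simp only [S, Finset.mem_filter, Finset.mem_univ, true_and] at hk hk'
    exact (hc k hk.1 l m hlm).elim hk.2 hk'.2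
  have hcard : ∀ l, 2 ≤ (S l).card := by
    intro l
    obtain ⟨k, -, hk⟩ := Finset.exists_ne_zero_of_sum_ne_zero (hsq l)
    have hpk : p k ≠ 0 := left_ne_zero_of_mul hk
    have hck : c k l ≠ 0 := left_ne_zero_of_mul (right_ne_zero_of_mul hk)
    by_contra! hlt
    have huniq : ∀ k', k' ≠ k → p k' * (α k' * c k' l) = 0 := by
      intro k' hne
      by_contra h
      refine hne (Finset.card_le_one.1 (Nat.lt_succ_iff.1 hlt) k' ?_ k ?_)
      · simpa [S] using ⟨left_ne_zero_of_mul h, right_ne_zero_of_mul (right_ne_zero_of_mul h)⟩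
      · simpa [S] using ⟨hpk, hck⟩
    have h := hsum l
    rw [Finset.sum_eq_single k (fun k' _ hne => huniq k' hne) (by simp)] at h
    exact mul_ne_zero hpk (mul_ne_zero (hα k) hck) h
  calc 2 * Fintype.card ι = ∑ _l : ι, 2 := by simp [mul_comm]
    _ ≤ ∑ l, (S l).card := Finset.sum_le_sum fun l _ => hcard l
    _ = (Finset.univ.biUnion S).card := (Finset.card_biUnion hdisj).symm
    _ ≤ Fintype.card κ := Finset.card_le_univ _

variable {d : ℕ} {u : Fin (d + 1) → OrthonormalBasis (Fin d) ℂ (EuclideanSpace ℂ (Fin d))}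

/-- A toroidal decomposition `C ⊕ 1 = ∑ₖ pₖ (xₖ ⊕ αₖ)(xₖ ⊕ αₖ)*` has at least `2 d` terms. With
`yₖ = A* xₖ / d`, so that `xₖ = A yₖ` when `pₖ ≠ 0`, the vectors `yₖ` of nonzero weight are
unbiased to the first `d` bases, `∑ₖ pₖ yₖ yₖ* = 1` and `∑ₖ pₖ ᾱₖ yₖ = 0`. -/
theorem le_of_hasToroidalDecomposition_mubCorrelationSum (hd : 0 < d) (hu : MutuallyUnbiased u)
    {N : ℕ} (h : HasToroidalDecomposition (mubCorrelationSum u (Fin 1)) N) : 2 * d ≤ N := by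
  have hd' : (d : ℂ) ≠ 0 := by exact_mod_cast hd.ne'
  obtain ⟨p, w, hp, -, hw, hC⟩ := h
  let x : Fin N → Fin d × Fin d → ℂ := fun k q => w k (Sum.inl q)
  -- the conjugate phases `ᾱₖ`, as they enter the off-diagonal block
  let α : Fin N → ℂ := fun k => star (w k (Sum.inr 0))
  have hCx : mubCorrelation u = ∑ k, (p k : ℂ) • Matrix.vecMulVec (x k) (star (x k)) := by
    ext q q'
    have h := congrFun (congrFun hC (Sum.inl q)) (Sum.inl q')
    simp only [Matrix.sum_apply] at h ⊢
    exact h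
  have hxα : ∑ k, ((p k : ℂ) * α k) • x k = 0 := by
    ext q
    have h := congrFun (congrFun hC (Sum.inl q)) (Sum.inr 0)
    rw [Matrix.sum_apply] at h
    rw [Finset.sum_apply]
    refine Eq.trans (Finset.sum_congr rfl fun k _ => ?_) h.symm
    simp only [x, α, Pi.smul_apply, Matrix.smul_apply, Matrix.vecMulVec_apply, smul_eq_mul,
      Pi.star_apply]
    ring
  -- a left inverse of `A`, so that `A M` is the projection onto the range of `A`
  let M : Matrix (Fin d) (Fin d × Fin d) ℂ := (1 / d : ℂ) • (mubMatrix u)ᴴ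
  have hMA : M * mubMatrix u = 1 := by
    simp [M, conjTranspose_mubMatrix_mul_mubMatrix, smul_smul, hd']
  let y : Fin N → EuclideanSpace ℂ (Fin d) := fun k => WithLp.toLp 2 (M *ᵥ x k)
  have hAy : ∀ k, p k ≠ 0 → ∀ q, inner ℂ (u q.1.castSucc q.2) (y k) = x k q := by
    intro k hk q
    have hQ : (1 - mubMatrix u * M) * mubCorrelation u = 0 := by
      rw [mubCorrelation, Matrix.sub_mul, Matrix.one_mul, ← Matrix.mul_assoc,
        Matrix.mul_assoc _ M, hMA, Matrix.mul_one, sub_self]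
    have h := congrFun (mulVec_eq_zero_of_sum_vecMulVec hQ hp hCx hk) q
    rw [Matrix.sub_mulVec, Matrix.one_mulVec, ← Matrix.mulVec_mulVec, Pi.sub_apply,
      Pi.zero_apply, sub_eq_zero] at h
    rw [← mubMatrix_mulVec, h]
  have hyy : ∑ k, (p k : ℂ) • Matrix.vecMulVec (y k).ofLp (star (y k).ofLp) = 1 := by
    have h : M * mubCorrelation u * Mᴴ = 1 := by
      rw [mubCorrelation, ← Matrix.mul_assoc, hMA, Matrix.one_mul, ← Matrix.conjTranspose_mul,
        hMA, Matrix.conjTranspose_one]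
    rw [hCx] at h
    simpa only [y, vecMulVec_mulVec_star_mulVec, Matrix.mul_sum, Matrix.sum_mul, Matrix.mul_smul,
      Matrix.smul_mul] using h
  have hyα : ∑ k, ((p k : ℂ) * α k) • (y k).ofLp = 0 := by
    simp only [y, ← Matrix.mulVec_smul, ← Matrix.mulVec_sum, hxα, Matrix.mulVec_zero]
  let v := u (Fin.last d)
  have key := two_mul_card_le (fun k => (p k : ℂ)) α (fun k l => inner ℂ (v l) (y k))
    (fun k h0 => by
      have := hw k (Sum.inr 0)
      rw [star_eq_zero.1 h0] at this
      simp at this)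
    (fun k hk l m hlm => by
      have hk' : p k ≠ 0 := by exact_mod_cast hk
      have h := hu.inner_last_mul_inner_last_eq_zero hd (y := y k)
        (fun t j => by rw [hAy k hk' (t, j)]; exact hw _ _) hlm
      exact (mul_eq_zero.1 h).imp_right inner_eq_zero_symm.1)
    (fun l => by
      have h : star (v l).ofLp ⬝ᵥ
          ((∑ k, (p k : ℂ) • Matrix.vecMulVec (y k).ofLp (star (y k).ofLp)) *ᵥ (v l).ofLp) = 1 := by
        rw [hyy, Matrix.one_mulVec, star_dotProduct_eq_inner]
        simp
      simp only [Matrix.sum_mulVec, dotProduct_sum, Matrix.smul_mulVec, dotProduct_smul,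
        star_dotProduct_vecMulVec_mulVec, smul_eq_mul] at h
      simp only [Complex.star_def, inner_conj_symm, h]
      exact one_ne_zero)
    (fun l => by
      have h := congrArg (star (v l).ofLp ⬝ᵥ ·) hyα
      simpa only [dotProduct_sum, dotProduct_smul, star_dotProduct_eq_inner, smul_eq_mul,
        dotProduct_zero, mul_assoc] using h)
  simpa using key

/-! ### The direct sum with a unitary channel -/

/-- Up to conjugation by the unitary `1 ⊕ U`, the direct sum of the Schur map of `C` and of
`X ↦ U X U*` is the Schur map of `C ⊕ J`. -/
theorem directSum_schurMap_apply {m : ℕ} {Ψ : MatMap (Fin m) (Fin m)}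
    {U : Matrix (Fin m) (Fin m) ℂ} (hΨ : ∀ X, Ψ X = U * X * Uᴴ)
    (X : Matrix ((Fin d × Fin d) ⊕ Fin m) ((Fin d × Fin d) ⊕ Fin m) ℂ) :
    directSum (schurMap (mubCorrelation u)) Ψ X
      = Matrix.fromBlocks 1 0 0 U * schurMap (mubCorrelationSum u (Fin m)) X
        * (Matrix.fromBlocks 1 0 0 U)ᴴ := by
  have hX : schurMap (mubCorrelationSum u (Fin m)) X
      = Matrix.fromBlocks (mubCorrelation u ⊙ X.toBlocks₁₁) 0 0 X.toBlocks₂₂ := by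
    ext (i | i) (j | j) <;>
      simp [schurMap, mubCorrelationSum, Matrix.toBlocks₁₁, Matrix.toBlocks₂₂]
  rw [hX, Matrix.fromBlocks_conjTranspose, Matrix.fromBlocks_multiply,
    Matrix.fromBlocks_multiply]
  simp [directSum, hΨ, schurMap]

theorem fromBlocks_one_mem_unitaryGroup {n m : Type*} [Fintype n] [Fintype m] [DecidableEq n]
    [DecidableEq m] {U : Matrix m m ℂ} (hU : U ∈ Matrix.unitaryGroup m ℂ) :
    Matrix.fromBlocks (1 : Matrix n n ℂ) 0 0 U ∈ Matrix.unitaryGroup (n ⊕ m) ℂ := by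
  rw [Matrix.mem_unitaryGroup_iff, Matrix.star_eq_conjTranspose,
    Matrix.fromBlocks_conjTranspose, Matrix.fromBlocks_multiply, ← Matrix.star_eq_conjTranspose U,
    Matrix.mem_unitaryGroup_iff.1 hU]
  simp

end LowerBound

end MUBChannel

theorem mainTheorem8 (d : ℕ) (hd : 0 < d)
    (u : Fin (d + 1) → OrthonormalBasis (Fin d) ℂ (EuclideanSpace ℂ (Fin d)))
    (hu : MUBChannel.MutuallyUnbiased u) :
    -- the matrix `C`
    (MUBChannel.IsCorrelationMatrix (MUBChannel.mubCorrelation u) ∧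
      (MUBChannel.mubCorrelation u).rank = d ∧
      MUBChannel.HasToroidalRank (MUBChannel.mubCorrelation u) d ∧
      ((MUBChannel.mubCorrelation u).map star ⊙ MUBChannel.mubCorrelation u).rank
        = d ^ 2 - d + 1) ∧
    -- the Schur channel of `C`
    (MUBChannel.IsChannel (MUBChannel.schurMap (MUBChannel.mubCorrelation u)) ∧
      MUBChannel.HasChoiRank (MUBChannel.schurMap (MUBChannel.mubCorrelation u)) d ∧
      Module.finrank ℂ
        (MUBChannel.operatorSystem (MUBChannel.schurMap (MUBChannel.mubCorrelation u)))
        = d ^ 2 - d + 1) ∧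
    -- its direct sum with any unitary channel
    (∀ (m : ℕ), 0 < m → ∀ Ψ : MUBChannel.MatMap (Fin m) (Fin m), MUBChannel.IsUnitaryChannel Ψ →
      MUBChannel.IsChannel
        (MUBChannel.directSum (MUBChannel.schurMap (MUBChannel.mubCorrelation u)) Ψ) ∧
      MUBChannel.IsMixedUnitary
        (MUBChannel.directSum (MUBChannel.schurMap (MUBChannel.mubCorrelation u)) Ψ) ∧
      MUBChannel.HasChoiRank
        (MUBChannel.directSum (MUBChannel.schurMap (MUBChannel.mubCorrelation u)) Ψ) (d + 1) ∧
      MUBChannel.HasMixedUnitaryRank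
        (MUBChannel.directSum (MUBChannel.schurMap (MUBChannel.mubCorrelation u)) Ψ) (2 * d)) ∧
    -- the correlation matrix `C ⊕ (1)`
    (MUBChannel.IsCorrelationMatrix
        (Matrix.fromBlocks (MUBChannel.mubCorrelation u) 0 0 (1 : Matrix (Fin 1) (Fin 1) ℂ)) ∧
      (Matrix.fromBlocks (MUBChannel.mubCorrelation u) 0 0
        (1 : Matrix (Fin 1) (Fin 1) ℂ)).rank = d + 1 ∧
      MUBChannel.HasToroidalRank
        (Matrix.fromBlocks (MUBChannel.mubCorrelation u) 0 0
          (1 : Matrix (Fin 1) (Fin 1) ℂ)) (2 * d)) := by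
  have hrank : (MUBChannel.unbiasedGram d d).rank = d ^ 2 - d + 1 := by
    have h := MUBChannel.rank_unbiasedGram hd hd
    have h2 : d ≤ d * d := Nat.le_mul_self d
    rw [sq]
    omega
  have hstar := MUBChannel.mubCorrelation_map_star_hadamard hu
  have htor := MUBChannel.hasToroidalDecomposition_mubCorrelation hd hu
  rw [← MUBChannel.mubCorrelationSum_fin_one]
  refine ⟨⟨MUBChannel.isCorrelationMatrix_mubCorrelation, MUBChannel.rank_mubCorrelation hd,
    ⟨htor, fun N hN => ?_⟩, by rw [hstar, hrank]⟩,
    ⟨(MUBChannel.hasMixedUnitaryDecomposition_schurMap_iff.2 htor).isChannel,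
      ⟨MUBChannel.hasKrausRepresentation_schurMap_mubCorrelation, fun r hr => ?_⟩,
      by rw [MUBChannel.finrank_operatorSystem_schurMap, hstar, hrank]⟩,
    fun m hm Ψ hΨ => ?_,
    MUBChannel.isCorrelationMatrix_mubCorrelationSum _,
    MUBChannel.rank_mubCorrelationSum_fin_one hd,
    MUBChannel.hasToroidalDecomposition_mubCorrelationSum hd hu _,
    fun N hN => MUBChannel.le_of_hasToroidalDecomposition_mubCorrelationSum hd hu hN⟩
  · rw [← MUBChannel.rank_mubCorrelation (u := u) hd]
    exact MUBChannel.rank_le_of_hasToroidalDecomposition hN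
  · rw [← MUBChannel.rank_mubCorrelation (u := u) hd]
    exact MUBChannel.rank_le_of_hasKrausRepresentation_schurMap hr
  · obtain ⟨U, hU, hΨ⟩ := hΨ
    have : Nonempty (Fin m) := ⟨⟨0, hm⟩⟩
    have hW := MUBChannel.fromBlocks_one_mem_unitaryGroup (n := Fin d × Fin d) hU
    have hsum := MUBChannel.directSum_schurMap_apply (u := u) hΨ
    have hmixed : ∀ N, _ ↔ _ := fun N =>
      (MUBChannel.hasMixedUnitaryDecomposition_conj_iff hW hsum (N := N)).trans
        MUBChannel.hasMixedUnitaryDecomposition_schurMap_iff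
    have hdec := (hmixed _).2
      (MUBChannel.hasToroidalDecomposition_mubCorrelationSum hd hu (Fin m))
    refine ⟨hdec.isChannel, ⟨_, hdec⟩, ⟨?_, fun r hr => ?_⟩, hdec, fun N hN => ?_⟩
    · exact (MUBChannel.hasKrausRepresentation_conj_iff hW hsum).2
        (MUBChannel.hasKrausRepresentation_schurMap_mubCorrelationSum _)
    · exact MUBChannel.le_of_hasKrausRepresentation_mubCorrelationSum hd
        ((MUBChannel.hasKrausRepresentation_conj_iff hW hsum).1 hr)
    · have h := ((hmixed N).1 hN).submatrix (Sum.map id fun _ : Fin 1 => (⟨0, hm⟩ : Fin m))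
      rw [MUBChannel.mubCorrelationSum_submatrix] at h
      exact MUBChannel.le_of_hasToroidalDecomposition_mubCorrelationSum hd hu h
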